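/- For $\theta\in\mathbb R$, $0<\sigma<\infty$ and $n\ge 1$ let $y_1,\dots,y_n$ be i.i.d. $N(\theta,\sigma^2)$ and let $P_{n,\theta,\sigma}$ denote the law of the sample. Put $\bar y=n^{-1}\sum_{i=1}^n y_i$ and, for $n\ge 2$, $\hat\sigma=\big((n-1)^{-1}\sum_{i=1}^n(y_i-\bar y)^2\big)^{1/2}$. For a threshold $\eta_n>0$ let $$\tilde\theta_S=\operatorname{sign}(\bar y)\,(|\bar y|-\hat\sigma\eta_n)_+,\qquad \hat\theta_S=\operatorname{sign}(\bar y)\,(|\bar y|-\sigma\eta_n)_+$$ be the feasible and the infeasible soft-thresholding (LASSO) estimators, where $\operatorname{sign}(0)=0$ and $z_+=\max\{z,0\}$. Let $T_{n-1}$ be the cumulative distribution function of Student's $t$-distribution with $n-1$ degrees of freedom. **Theorem.** Let $\sigma>0$, let $(\eta_n)$ be a sequence of positive real numbers and $(a_n)$ a sequence of nonnegative real numbers. Put $E_{S,n}=[\tilde\theta_S-\hat\sigma a_n,\ \tilde\theta_S+\hat\sigma a_n]$ and $C_{S,n}=[\hat\theta_S-\sigma a_n,\ \hat\theta_S+\sigma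 a_n]$ (for $\sigma=1$ the latter is $[\hat\theta_S-a_n,\hat\theta_S+a_n]$). Then for every $n\ge 2$ $$\inf_{\theta\in\mathbb R}P_{n,\theta,\sigma}(\theta\in E_{S,n})=T_{n-1}\big(\sqrt n\,(a_n-\eta_n)\big)-T_{n-1}\big(\sqrt n\,(-a_n-\eta_n)\big),$$ and, as $n\to\infty$, $$\inf_{\theta\in\mathbb R}P_{n,\theta,\sigma}(\theta\in E_{S,n})-\inf_{\theta\in\mathbb R}P_{n,\theta,\sigma}(\theta\in C_{S,n})\to 0.$$ Both assertions also hold when $E_{S,n}$ and $C_{S,n}$ are both replaced by the corresponding open intervals, or both by the corresponding half-open intervals (open on the left, or open on the right). -/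

import Mathlib

open MeasureTheory ProbabilityTheory Filter Topology

noncomputable section

/-- The law of a sample of `n` independent observations, each distributed as `N(θ, σ²)`. -/
def sampleLaw (n : ℕ) (θ σ : ℝ) : Measure (Fin n → ℝ) :=
  Measure.pi fun _ => gaussianReal θ (σ ^ 2).toNNReal

/-- The arithmetic mean of the data. -/
def sampleMean {n : ℕ} (y : Fin n → ℝ) : ℝ :=
  (∑ i, y i) / n

/-- The standard deviation estimator: the square root of
`(n - 1)⁻¹ ∑ (yᵢ - ȳ)²` (used for `n ≥ 2`). -/
def sampleSD {n : ℕ} (y : Fin n → ℝ) : ℝ :=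
  √((∑ i, (y i - sampleMean y) ^ 2) / ((n : ℝ) - 1))

/-- Soft-thresholding of `x` at level `t`. -/
def softThreshold (t x : ℝ) : ℝ :=
  Real.sign x * max (|x| - t) 0

/-- The feasible soft-thresholding (LASSO) estimator, with threshold `sampleSD y * η`. -/
def softFeasible {n : ℕ} (η : ℝ) (y : Fin n → ℝ) : ℝ :=
  softThreshold (sampleSD y * η) (sampleMean y)

/-- The infeasible soft-thresholding estimator, with threshold `σ * η`. -/
def softInfeasible {n : ℕ} (σ η : ℝ) (y : Fin n → ℝ) : ℝ :=
  softThreshold (σ * η) (sampleMean y)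

/-- Infimum over `θ` of the coverage probability of the unknown-variance interval with
endpoints `softFeasible η y ∓ sampleSD y * a`. The argument `I` (one of `Set.Icc`, `Set.Ioo`,
`Set.Ioc`, `Set.Ico`) says which endpoints belong to the interval. -/
def infCoverageUnknown (I : ℝ → ℝ → Set ℝ) (n : ℕ) (σ η a : ℝ) : ℝ :=
  ⨅ θ : ℝ, (sampleLaw n θ σ).real
    {y | θ ∈ I (softFeasible η y - sampleSD y * a) (softFeasible η y + sampleSD y * a)}

/-- Infimum over `θ` of the coverage probability of the known-variance interval with
endpoints `softInfeasible σ η y ∓ σ * a`. -/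
def infCoverageKnown (I : ℝ → ℝ → Set ℝ) (n : ℕ) (σ η a : ℝ) : ℝ :=
  ⨅ θ : ℝ, (sampleLaw n θ σ).real
    {y | θ ∈ I (softInfeasible σ η y - σ * a) (softInfeasible σ η y + σ * a)}

/-- The chi-square distribution with `k` degrees of freedom: the law of the sum of the squares
of `k` independent standard normal variables. -/
def chiSquareLaw (k : ℕ) : Measure ℝ :=
  (Measure.pi fun _ : Fin k => gaussianReal 0 1).map fun z => ∑ i, z i ^ 2

/-- Student's `t`-distribution with `k ≥ 1` degrees of freedom: the law of `Z / √(V / k)` with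
`Z` standard normal, `V` chi-square with `k` degrees of freedom, `Z` and `V` independent. -/
def studentTLaw (k : ℕ) : Measure ℝ :=
  ((gaussianReal 0 1).prod (chiSquareLaw k)).map fun p => p.1 / √(p.2 / k)

instance (k : ℕ) : IsProbabilityMeasure (chiSquareLaw k) :=
  Measure.isProbabilityMeasure_map (Measurable.aemeasurable (by fun_prop))

instance (k : ℕ) : IsProbabilityMeasure (studentTLaw k) :=
  Measure.isProbabilityMeasure_map (by fun_prop)

/-- The cumulative distribution function of Student's `t`-distribution. -/
def studentTCDF (k : ℕ) (x : ℝ) : ℝ :=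
  cdf (studentTLaw k) x

end

/-!
Write the observation as `θ + X`, with scale `S` (the sample standard deviation or the known `σ`),
threshold `S η` and half-length `S a`. Soft-thresholding shifts every observation towards zero by
at most `S η`. Hence for `θ ≥ 0` the interval covers `θ` whenever `S (η - a) < X < S (η + a)`, and
for `θ ≤ 0` whenever `-X` satisfies these bounds
(`mem_Ioo_softThreshold_of_nonneg`, `mem_Ioo_softThreshold_of_nonpos`). These events depend on
`X / S` alone, and by symmetry have the same probability. Conversely, for `θ > S a` coverage
implies the bounds (`bounds_of_mem_Icc_softThreshold`), and `P(θ ≤ S a) → 0` as `θ → ∞`. So the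
infimal coverage probability is the mass which the law of `X / S` gives to the interval between
`η - a` and `η + a` (`iInf_coverage_softThreshold`); neither conditioning on `S` nor its
independence of `X` is needed, and the endpoints do not matter because the law has no atoms.

For the Gaussian sample, Fisher's lemma (`map_pi_gaussianReal_sampleMean_sumSq`) identifies the law
of `√n X / S` as Student's distribution when `S` is the sample standard deviation, while it is
standard normal when `S = σ`. The difference of the two infima is then controlled by the uniform
distance between the distribution functions `T_k` and `Φ`. As `T_k(x) = E Φ(x √(V / k))` with `V`
chi-square, and `|Φ(x w) - Φ(x)| ≤ 2 |w - 1|` for all `x`, this distance is at most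
`2 E|V / k - 1|`, which is of order `k ^ (-1/2)` by the variance of `V`
(`abs_studentTCDF_sub_cdf_gaussianReal_le`).
-/

/-! ### Coverage events of the soft-thresholding interval -/

/-- A piecewise linear form of the soft-threshold function, free of the sign function. -/
lemma softThreshold_eq {t : ℝ} (ht : 0 ≤ t) (x : ℝ) :
    softThreshold t x = max (x - t) 0 - max (-x - t) 0 := by
  unfold softThreshold
  rcases lt_trichotomy x 0 with h | h | h
  · rw [Real.sign_of_neg h, abs_of_neg h, max_eq_right (a := x - t) (by linarith)]; ring
  · subst h; simp
  · rw [Real.sign_of_pos h, abs_of_pos h, max_eq_right (a := -x - t) (by linarith)]; ring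

/-- For `θ ≥ 0` covering `θ` is guaranteed by bounds on the error `x` that do not involve `θ`. -/
lemma mem_Ioo_softThreshold_of_nonneg {θ x s η a : ℝ} (hs : 0 ≤ s) (hη : 0 < η) (ha : 0 ≤ a)
    (hθ : 0 ≤ θ) (h1 : s * (η - a) < x) (h2 : x < s * (η + a)) :
    θ ∈ Set.Ioo (softThreshold (s * η) (θ + x) - s * a)
      (softThreshold (s * η) (θ + x) + s * a) := by
  have ht : 0 ≤ s * η := by positivity
  have hc : 0 ≤ s * a := by positivity
  rw [softThreshold_eq ht, Set.mem_Ioo]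
  grind

lemma mem_Ioo_softThreshold_of_nonpos {θ x s η a : ℝ} (hs : 0 ≤ s) (hη : 0 < η) (ha : 0 ≤ a)
    (hθ : θ ≤ 0) (h1 : s * (η - a) < -x) (h2 : -x < s * (η + a)) :
    θ ∈ Set.Ioo (softThreshold (s * η) (θ + x) - s * a)
      (softThreshold (s * η) (θ + x) + s * a) := by
  have ht : 0 ≤ s * η := by positivity
  have hc : 0 ≤ s * a := by positivity
  rw [softThreshold_eq ht, Set.mem_Ioo]
  grind

/-- Once `θ` exceeds the half-length `s * a`, covering `θ` forces the estimator to be positive, so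
that no observation is set to zero and the error has to lie between the shifted bounds. -/
lemma bounds_of_mem_Icc_softThreshold {θ x s η a : ℝ} (hs : 0 ≤ s) (hη : 0 < η) (ha : 0 ≤ a)
    (hθ : s * a < θ)
    (h : θ ∈ Set.Icc (softThreshold (s * η) (θ + x) - s * a)
      (softThreshold (s * η) (θ + x) + s * a)) :
    s * (η - a) ≤ x ∧ x ≤ s * (η + a) := by
  have ht : 0 ≤ s * η := by positivity
  have hc : 0 ≤ s * a := by positivity
  rw [softThreshold_eq ht, Set.mem_Icc] at h
  grind

/-! ### Sample mean and sample variance under normality -/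

/-- **Fisher's lemma**: for a standard normal sample the normalized mean is standard normal,
the sum of squared deviations is chi-square, and the two are independent. An orthonormal basis
whose first vector is the normalized constant one turns the two statistics into the first
coordinate and the squared length of the others. -/
lemma map_pi_gaussianReal_sampleMean_sumSq (k : ℕ) :
    (Measure.pi fun _ : Fin (k + 1) => gaussianReal 0 1).map
      (fun z => (√((k + 1 : ℕ) : ℝ) * sampleMean z, ∑ i, (z i - sampleMean z) ^ 2)) =
    (gaussianReal 0 1).prod (chiSquareLaw k) := by
  set c : ℝ := √((k + 1 : ℕ) : ℝ) with hc
  have hc0 : 0 < c := by rw [hc]; positivity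
  have hc2 : c ^ 2 = (k + 1 : ℕ) := Real.sq_sqrt (by positivity)
  let e : EuclideanSpace ℝ (Fin (k + 1)) := WithLp.toLp 2 fun _ => c⁻¹
  have he : ‖e‖ = 1 := by
    rw [EuclideanSpace.norm_eq]
    simp [e, ← hc2, hc0.ne']
  obtain ⟨b, hb⟩ := Orthonormal.exists_orthonormalBasis_extension_of_card_eq (𝕜 := ℝ)
    (ι := Fin (k + 1)) (v := fun _ => e) (s := {0}) (by simp) (by
      refine ⟨fun _ => he, fun i j hij => (hij (Subsingleton.elim _ _)).elim⟩)
  have hb0 : b 0 = e := hb 0 rfl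
  let U : (Fin (k + 1) → ℝ) → Fin (k + 1) → ℝ := fun z => (b.repr (WithLp.toLp 2 z)).ofLp
  have hUm : Measurable U := by fun_prop
  have hU : (Measure.pi fun _ : Fin (k + 1) => gaussianReal 0 1).map U =
      Measure.pi fun _ : Fin (k + 1) => gaussianReal 0 1 := by
    have h1 : U = (WithLp.ofLp) ∘ (b.repr ∘ WithLp.toLp 2) := rfl
    rw [h1, ← Measure.map_map (by fun_prop) (by fun_prop),
      ← Measure.map_map (by fun_prop) (by fun_prop), map_pi_eq_stdGaussian, stdGaussian_map,
      ← map_pi_eq_stdGaussian, Measure.map_map (by fun_prop) (by fun_prop)]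
    exact Measure.map_id
  have hU0 (z) : U z 0 = c * sampleMean z := by
    have : U z 0 = c⁻¹ * ∑ i, z i := by
      simp only [U, b.repr_apply_apply, hb0, e, PiLp.inner_apply]
      simp [Finset.sum_mul, mul_comm]
    rw [this, sampleMean, ← hc2]
    field_simp
  have hUs (z) : ∑ i, (U z i) ^ 2 = ∑ i, z i ^ 2 := by
    have := b.repr.norm_map (WithLp.toLp 2 z)
    rw [EuclideanSpace.norm_eq, EuclideanSpace.norm_eq,
      Real.sqrt_inj (by positivity) (by positivity)] at this
    simpa using this
  have hss (z : Fin (k + 1) → ℝ) :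
      ∑ i, (z i - sampleMean z) ^ 2 = ∑ i : Fin k, (U z i.succ) ^ 2 := by
    have h1 := hUs z
    rw [Fin.sum_univ_succ, hU0, mul_pow, hc2] at h1
    have h2 : ∑ i, z i = (k + 1 : ℕ) * sampleMean z := by
      unfold sampleMean; field_simp
    simp only [sub_sq, Finset.sum_add_distrib, Finset.sum_sub_distrib, ← Finset.sum_mul,
      ← Finset.mul_sum, h2]
    simp only [Finset.sum_const, Finset.card_univ, Fintype.card_fin, nsmul_eq_mul]
    linarith
  have hfun : (fun z : Fin (k + 1) → ℝ => (c * sampleMean z, ∑ i, (z i - sampleMean z) ^ 2)) =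
      (Prod.map id (fun w : Fin k → ℝ => ∑ i, w i ^ 2)) ∘
        (MeasurableEquiv.piFinSuccAbove (fun _ => ℝ) 0) ∘ U := by
    funext z
    simp [hss, ← hU0, MeasurableEquiv.piFinSuccAbove, Fin.tail]
  rw [hfun, ← Measure.map_map (by fun_prop) (by fun_prop),
    ← Measure.map_map (by fun_prop) hUm, hU,
    (measurePreserving_piFinSuccAbove (fun _ : Fin (k + 1) => gaussianReal 0 1) 0).map_eq,
    ← Measure.map_prod_map _ _ measurable_id (by fun_prop), Measure.map_id]
  rfl

lemma ae_chiSquareLaw_pos {k : ℕ} (hk : 0 < k) : ∀ᵐ v ∂chiSquareLaw k, 0 < v := by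
  rw [chiSquareLaw, ae_map_iff (Measurable.aemeasurable (by fun_prop)) measurableSet_Ioi]
  have hna := nullSingletonClass_gaussianReal (μ := 0) (v := 1) one_ne_zero
  have h := (measurePreserving_eval (fun _ : Fin k => gaussianReal 0 1)
    ⟨0, hk⟩).quasiMeasurePreserving.ae (Measure.ae_ne (gaussianReal 0 1) 0)
  filter_upwards [h] with z hz
  exact Finset.sum_pos' (fun i _ => sq_nonneg _) ⟨⟨0, hk⟩, Finset.mem_univ _, by positivity⟩

lemma sampleLaw_eq_map (n : ℕ) (θ σ : ℝ) :
    sampleLaw n θ σ = (Measure.pi fun _ : Fin n => gaussianReal 0 1).map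
      (fun z i => θ + σ * z i) := by
  rw [Measure.pi_map_pi (f := fun _ x => θ + σ * x) (by fun_prop)]
  unfold sampleLaw
  congr 1
  funext i
  have : (fun x : ℝ => θ + σ * x) = (fun x => θ + x) ∘ (fun x => σ * x) := rfl
  rw [this, ← Measure.map_map (by fun_prop) (by fun_prop), gaussianReal_map_const_mul,
    gaussianReal_map_const_add]
  congr 1
  · simp
  · ext; simp [sq_nonneg]

lemma sampleMean_affine {n : ℕ} (hn : n ≠ 0) (θ σ : ℝ) (z : Fin n → ℝ) :
    sampleMean (fun i => θ + σ * z i) = θ + σ * sampleMean z := by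
  simp only [sampleMean, Finset.sum_add_distrib, ← Finset.mul_sum, Finset.sum_const,
    Finset.card_univ, Fintype.card_fin, nsmul_eq_mul]
  field_simp

lemma sampleSD_affine {n : ℕ} (hn : n ≠ 0) (θ : ℝ) {σ : ℝ} (hσ : 0 ≤ σ) (z : Fin n → ℝ) :
    sampleSD (fun i => θ + σ * z i) = σ * sampleSD z := by
  simp only [sampleSD, sampleMean_affine hn]
  have h (i : Fin n) : (θ + σ * z i - (θ + σ * sampleMean z)) ^ 2 = σ ^ 2 * (z i - sampleMean z) ^ 2 := by
    ring
  simp only [h, ← Finset.mul_sum, mul_div_assoc]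
  rw [Real.sqrt_mul (by positivity), Real.sqrt_sq hσ]

/-! ### Minimal coverage for a general error law -/

lemma measureReal_Ioc_eq_cdf_sub (ν : Measure ℝ) [IsProbabilityMeasure ν] {l u : ℝ} (h : l ≤ u) :
    ν.real (Set.Ioc l u) = cdf ν u - cdf ν l := by
  rw [cdf_eq_real, cdf_eq_real, ← Set.Iic_sdiff_Iic,
    measureReal_sdiff (Set.Iic_subset_Iic.2 h) measurableSet_Iic]

/-- The infimal coverage probability of the soft-thresholding interval, for an observation `θ + X`
with scale `S`, in terms of the (symmetric, atomless) law `ν` of the studentized error `c X / S`.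
No independence of `X` and `S` is needed: for `θ ≥ 0` and for `θ ≤ 0` the coverage event contains
an event about `X / S` that is free of `θ`, and both of these have the same probability. -/
theorem iInf_coverage_softThreshold {Ω : Type*} [MeasurableSpace Ω] {μ : Measure Ω}
    [IsProbabilityMeasure μ] {X S : Ω → ℝ} (hX : Measurable X) (hS : Measurable S)
    (hS0 : ∀ ω, 0 ≤ S ω) (hSpos : ∀ᵐ ω ∂μ, 0 < S ω) {c : ℝ} (hc : 0 < c)
    {ν : Measure ℝ} [IsProbabilityMeasure ν] [NullSingletonClass ν]
    (hν : μ.map (fun ω => c * X ω / S ω) = ν) (hsymm : ν.map (fun x => -x) = ν)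
    {η a : ℝ} (hη : 0 < η) (ha : 0 ≤ a) {I : ℝ → ℝ → Set ℝ}
    (hI1 : ∀ l u, Set.Ioo l u ⊆ I l u) (hI2 : ∀ l u, I l u ⊆ Set.Icc l u) :
    ⨅ θ : ℝ, μ.real {ω | θ ∈ I (softThreshold (S ω * η) (θ + X ω) - S ω * a)
        (softThreshold (S ω * η) (θ + X ω) + S ω * a)} =
      cdf ν (c * (a - η)) - cdf ν (c * (-a - η)) := by
  set p := cdf ν (c * (a - η)) - cdf ν (c * (-a - η)) with hp
  have hlu : c * (-a - η) ≤ c * (a - η) := by gcongr; linarith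
  have hm : Measurable fun ω => c * X ω / S ω := by fun_prop
  have hIoo : ν.real (Set.Ioo (c * (-a - η)) (c * (a - η))) = p := by
    rw [hp, ← measureReal_Ioc_eq_cdf_sub ν hlu]
    exact measureReal_congr Ioo_ae_eq_Ioc
  have hIcc : ν.real (Set.Icc (c * (η - a)) (c * (η + a))) = p := by
    rw [hp, ← measureReal_Ioc_eq_cdf_sub ν hlu]
    conv_lhs => rw [← hsymm]
    rw [map_measureReal_apply (by fun_prop) measurableSet_Icc,
      show (fun x : ℝ => -x) ⁻¹' Set.Icc (c * (η - a)) (c * (η + a)) =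
        Set.Icc (c * (-a - η)) (c * (a - η)) by
          ext x; simp only [Set.mem_preimage, Set.mem_Icc]; constructor <;> rintro ⟨_, _⟩ <;>
            constructor <;> linarith]
    exact measureReal_congr Ioc_ae_eq_Icc.symm
  have hIoo' : ν.real (Set.Ioo (c * (η - a)) (c * (η + a))) = p := by
    rw [← hIcc]; exact measureReal_congr Ioo_ae_eq_Icc
  have hpos : μ.real {ω | S ω * (η - a) < X ω ∧ X ω < S ω * (η + a)} = p := by
    rw [← hIoo', ← hν, map_measureReal_apply hm measurableSet_Ioo]
    refine measureReal_congr ?_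
    filter_upwards [hSpos] with ω h
    refine propext (show _ ∧ _ ↔ _ ∧ _ from ?_)
    rw [lt_div_iff₀ h, div_lt_iff₀ h, mul_assoc, mul_assoc, mul_lt_mul_iff_right₀ hc,
      mul_lt_mul_iff_right₀ hc, mul_comm (S ω), mul_comm (S ω)]
  have hneg : μ.real {ω | S ω * (η - a) < -X ω ∧ -X ω < S ω * (η + a)} = p := by
    rw [← hIoo, ← hν, map_measureReal_apply hm measurableSet_Ioo]
    refine measureReal_congr ?_
    filter_upwards [hSpos] with ω h
    refine propext (show _ ∧ _ ↔ _ ∧ _ from ?_)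
    rw [lt_div_iff₀ h, div_lt_iff₀ h, mul_assoc, mul_assoc, mul_lt_mul_iff_right₀ hc,
      mul_lt_mul_iff_right₀ hc]
    constructor <;> rintro ⟨_, _⟩ <;> constructor <;> linarith
  have hcl : μ.real {ω | S ω * (η - a) ≤ X ω ∧ X ω ≤ S ω * (η + a)} = p := by
    rw [← hIcc, ← hν, map_measureReal_apply hm measurableSet_Icc]
    refine measureReal_congr ?_
    filter_upwards [hSpos] with ω h
    refine propext (show _ ∧ _ ↔ _ ∧ _ from ?_)
    rw [le_div_iff₀ h, div_le_iff₀ h, mul_assoc, mul_assoc, mul_le_mul_iff_right₀ hc,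
      mul_le_mul_iff_right₀ hc, mul_comm (S ω), mul_comm (S ω)]
  apply le_antisymm
  · -- As `θ → ∞` the coverage probability is at most `p` plus a vanishing term.
    set τ := μ.map fun ω => S ω * a with hτ
    have hSa : Measurable fun ω => S ω * a := by fun_prop
    have : IsProbabilityMeasure τ := Measure.isProbabilityMeasure_map hSa.aemeasurable
    have hlim : Tendsto (fun θ : ℝ => p + (1 - cdf τ (θ - 1))) atTop (𝓝 (p + (1 - 1))) :=
      tendsto_const_nhds.add (tendsto_const_nhds.sub
        ((tendsto_cdf_atTop τ).comp (tendsto_atTop_add_const_right _ _ tendsto_id)))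
    rw [sub_self, add_zero] at hlim
    refine ge_of_tendsto hlim (Eventually.of_forall fun θ => ?_)
    refine (ciInf_le ⟨0, by rintro _ ⟨θ, rfl⟩; exact measureReal_nonneg⟩ θ).trans ?_
    -- Only the event that `θ` does not exceed the half-length `S * a` can add coverage. The shift
    -- by one makes room for the strict inequality in the complement of `Iic`.
    have htail : μ.real {ω | θ - 1 < S ω * a} = 1 - cdf τ (θ - 1) := by
      rw [cdf_eq_real, ← probReal_compl_eq_one_sub measurableSet_Iic, Set.compl_Iic, hτ,
        map_measureReal_apply hSa measurableSet_Ioi]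
      rfl
    rw [← hcl, ← htail]
    refine (measureReal_mono ?_).trans (measureReal_union_le _ _)
    intro ω hω
    by_cases h : S ω * a < θ
    · exact Or.inl (bounds_of_mem_Icc_softThreshold (hS0 ω) hη ha h (hI2 _ _ hω))
    · exact Or.inr (by simp only [Set.mem_ofPred_eq]; linarith)
  · refine le_ciInf fun θ => ?_
    rcases le_total 0 θ with h | h
    · rw [← hpos]
      exact measureReal_mono fun ω hω => hI1 _ _
        (mem_Ioo_softThreshold_of_nonneg (hS0 ω) hη ha h hω.1 hω.2)
    · rw [← hneg]
      exact measureReal_mono fun ω hω => hI1 _ _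
        (mem_Ioo_softThreshold_of_nonpos (hS0 ω) hη ha h hω.1 hω.2)

/-! ### Student's distribution -/

/-- Student's `t`-distribution as a scale mixture of centred normal distributions. -/
lemma studentTLaw_apply (k : ℕ) {s : Set ℝ} (hs : MeasurableSet s) :
    studentTLaw k s =
      ∫⁻ v, gaussianReal 0 1 ((fun z => z / √(v / k)) ⁻¹' s) ∂chiSquareLaw k := by
  rw [studentTLaw, Measure.map_apply (by fun_prop) hs,
    Measure.prod_apply_symm (hs.preimage (by fun_prop))]
  rfl

lemma nullSingletonClass_studentTLaw {k : ℕ} (hk : 0 < k) :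
    NullSingletonClass (studentTLaw k) := by
  have hna := nullSingletonClass_gaussianReal (μ := 0) (v := 1) one_ne_zero
  refine ⟨fun x => ?_⟩
  rw [studentTLaw_apply k (measurableSet_singleton x), lintegral_eq_zero_iff' (by
    exact (measurable_measure_prodMk_right
      (s := {p : ℝ × ℝ | p.1 / √(p.2 / k) ∈ ({x} : Set ℝ)})
      ((measurableSet_singleton x).preimage (by fun_prop))).aemeasurable)]
  filter_upwards [ae_chiSquareLaw_pos hk] with v hv
  have : 0 < √(v / k) := by positivity
  refine measure_mono_null (t := {x * √(v / k)}) (fun z hz => ?_) (measure_singleton _)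
  rwa [Set.mem_preimage, Set.mem_singleton_iff, div_eq_iff this.ne'] at hz

lemma gaussianReal_zero_map_neg :
    (gaussianReal 0 1).map (fun x => -x) = gaussianReal 0 1 := by
  rw [gaussianReal_map_neg, neg_zero]

lemma studentTLaw_map_neg (k : ℕ) : (studentTLaw k).map (fun x => -x) = studentTLaw k := by
  have h : ((gaussianReal 0 1).prod (chiSquareLaw k)).map (Prod.map (fun x => -x) id) =
      (gaussianReal 0 1).prod (chiSquareLaw k) := by
    rw [← Measure.map_prod_map _ _ (by fun_prop) (by fun_prop), gaussianReal_zero_map_neg,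
      Measure.map_id]
  conv_rhs => rw [studentTLaw, ← h, Measure.map_map (by fun_prop) (by fun_prop)]
  rw [studentTLaw, Measure.map_map (by fun_prop) (by fun_prop)]
  congr 1
  funext p
  simp [neg_div]

lemma studentTCDF_eq_integral {k : ℕ} (hk : 0 < k) (x : ℝ) :
    studentTCDF k x = ∫ v, cdf (gaussianReal 0 1) (x * √(v / k)) ∂chiSquareLaw k := by
  rw [studentTCDF, cdf_eq_real, measureReal_def, studentTLaw_apply k measurableSet_Iic,
    integral_eq_lintegral_of_nonneg_ae (Eventually.of_forall fun v => cdf_nonneg _ _)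
      ((monotone_cdf _).measurable.comp (by fun_prop)).aestronglyMeasurable]
  congr 1
  refine lintegral_congr_ae ?_
  filter_upwards [ae_chiSquareLaw_pos hk] with v hv
  have : 0 < √(v / k) := by positivity
  rw [ofReal_cdf]
  congr 1
  ext z
  exact div_le_iff₀ this

/-! ### Normal approximation of Student's distribution -/

lemma gaussianPDFReal_le_inv {u x : ℝ} (hu : 0 < u) (hx : u ≤ x) :
    gaussianPDFReal 0 1 x ≤ u⁻¹ := by
  have hx0 : 0 < x := hu.trans_le hx
  have h1 : (√(2 * Real.pi * (1 : NNReal)))⁻¹ ≤ 1 := by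
    apply inv_le_one_of_one_le₀
    rw [Real.one_le_sqrt]
    have := Real.pi_gt_three
    simp only [NNReal.coe_one]
    linarith
  have h2 : Real.exp (-(x - 0) ^ 2 / (2 * (1 : NNReal))) ≤ u⁻¹ := by
    rw [neg_div, Real.exp_neg]
    apply inv_anti₀ hu
    have := Real.add_one_le_exp ((x - 0) ^ 2 / (2 * (1 : NNReal)))
    simp only [NNReal.coe_one, mul_one, sub_zero] at this ⊢
    nlinarith [sq_nonneg (x - 1)]
  rw [gaussianPDFReal_def]
  calc _ ≤ 1 * u⁻¹ := mul_le_mul h1 h2 (Real.exp_nonneg _) zero_le_one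
    _ = _ := one_mul _

lemma cdf_gaussianReal_sub_le {u v : ℝ} (hu : 0 < u) (huv : u ≤ v) :
    cdf (gaussianReal 0 1) v - cdf (gaussianReal 0 1) u ≤ (v - u) / u := by
  rw [← measureReal_Ioc_eq_cdf_sub _ huv, measureReal_def]
  refine ENNReal.toReal_le_of_le_ofReal (div_nonneg (by linarith) hu.le) ?_
  rw [gaussianReal_apply _ one_ne_zero]
  calc ∫⁻ x in Set.Ioc u v, gaussianPDF 0 1 x
      ≤ ∫⁻ _ in Set.Ioc u v, ENNReal.ofReal u⁻¹ :=
        setLIntegral_mono measurable_const fun x hx =>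
          ENNReal.ofReal_le_ofReal (gaussianPDFReal_le_inv hu hx.1.le)
    _ = ENNReal.ofReal ((v - u) / u) := by
        rw [setLIntegral_const, Real.volume_Ioc, ← ENNReal.ofReal_mul (by positivity)]
        congr 1; field_simp

lemma cdf_gaussianReal_neg (x : ℝ) :
    cdf (gaussianReal 0 1) (-x) = 1 - cdf (gaussianReal 0 1) x := by
  have hna := nullSingletonClass_gaussianReal (μ := 0) (v := 1) one_ne_zero
  rw [cdf_eq_real, cdf_eq_real, ← probReal_compl_eq_one_sub measurableSet_Iic, Set.compl_Iic]
  conv_lhs => rw [← gaussianReal_zero_map_neg]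
  rw [map_measureReal_apply (by fun_prop) measurableSet_Iic,
    show (fun x : ℝ => -x) ⁻¹' Set.Iic (-x) = Set.Ici x by ext; simp]
  exact measureReal_congr Ioi_ae_eq_Ici.symm

/-- Rescaling the argument changes the standard normal distribution function little,
uniformly in the argument, since the density at `x` is at most `1 / |x|`. For `w ≤ 1 / 2`, where
this bound degenerates, the right-hand side is at least one. -/
lemma abs_cdf_gaussianReal_mul_sub_le (x w : ℝ) :
    |cdf (gaussianReal 0 1) (x * w) - cdf (gaussianReal 0 1) x| ≤ 2 * |w - 1| := by
  set F := cdf (gaussianReal 0 1) with hF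
  have key (y : ℝ) (hy : 0 < y) : |F (y * w) - F y| ≤ 2 * |w - 1| := by
    rcases le_total 1 w with h | h
    · have hyw : y ≤ y * w := le_mul_of_one_le_right hy.le h
      have h1 := cdf_gaussianReal_sub_le hy hyw
      rw [show (y * w - y) / y = w - 1 by field_simp] at h1
      rw [abs_of_nonneg (sub_nonneg.2 (monotone_cdf _ hyw)), abs_of_nonneg (by linarith)]
      linarith
    · have hyw : y * w ≤ y := mul_le_of_le_one_right hy.le h
      rw [abs_sub_comm, abs_of_nonneg (sub_nonneg.2 (monotone_cdf _ hyw)), abs_sub_comm w,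
        abs_of_nonneg (by linarith)]
      rcases le_total w (1 / 2) with h' | h'
      · have := cdf_le_one (gaussianReal 0 1) y
        have := cdf_nonneg (gaussianReal 0 1) (y * w)
        linarith
      · have hw0 : 0 < w := by linarith
        have h1 := cdf_gaussianReal_sub_le (mul_pos hy hw0) hyw
        refine h1.trans ?_
        rw [show (y - y * w) / (y * w) = (1 - w) / w by field_simp, div_le_iff₀ hw0]
        nlinarith
  rcases lt_trichotomy x 0 with h | h | h
  · have h1 := key (-x) (by linarith)
    rw [neg_mul, hF, cdf_gaussianReal_neg, cdf_gaussianReal_neg] at h1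
    rw [abs_sub_comm]
    convert h1 using 2
    ring
  · simp [h]
  · exact key x h

lemma memLp_sq_gaussianReal : MemLp (fun x : ℝ => x ^ 2) 2 (gaussianReal 0 1) := by
  rw [memLp_two_iff_integrable_sq (by fun_prop)]
  have h := (memLp_id_gaussianReal (μ := 0) (v := 1) 4).integrable_norm_pow (p := 4) (by norm_num)
  refine h.congr (Eventually.of_forall fun x => ?_)
  simp only [id, Real.norm_eq_abs]
  rw [← pow_mul, Even.pow_abs (by decide)]

lemma integral_sq_gaussianReal : ∫ x, x ^ 2 ∂gaussianReal 0 1 = 1 := by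
  have h := variance_fun_id_gaussianReal (μ := 0) (v := 1)
  rw [variance_of_integral_eq_zero (by fun_prop) integral_id_gaussianReal] at h
  simpa using h

lemma memLp_sum_sq_pi (k : ℕ) : MemLp (fun z : Fin k → ℝ => ∑ i, z i ^ 2) 2
    (Measure.pi fun _ : Fin k => gaussianReal 0 1) :=
  memLp_finsetSum _ fun i _ =>
    memLp_sq_gaussianReal.comp_measurePreserving
      (measurePreserving_eval (fun _ : Fin k => gaussianReal 0 1) i)

lemma memLp_id_chiSquareLaw (k : ℕ) : MemLp (fun v => v) 2 (chiSquareLaw k) := by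
  rw [chiSquareLaw, memLp_map_measure_iff (by fun_prop) (Measurable.aemeasurable (by fun_prop))]
  exact memLp_sum_sq_pi k

lemma integral_id_chiSquareLaw (k : ℕ) : ∫ v, v ∂chiSquareLaw k = k := by
  rw [chiSquareLaw, integral_map (Measurable.aemeasurable (by fun_prop)) (by fun_prop),
    integral_finsetSum _ fun i _ => integrable_comp_eval
      (μ := fun _ : Fin k => gaussianReal 0 1) (memLp_sq_gaussianReal.integrable (by norm_num))]
  simp [integral_comp_eval (μ := fun _ : Fin k => gaussianReal 0 1) (f := fun x : ℝ => x ^ 2)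
    (by fun_prop), integral_sq_gaussianReal]

lemma variance_id_chiSquareLaw (k : ℕ) :
    Var[fun v => v; chiSquareLaw k] = k * Var[fun x => x ^ 2; gaussianReal 0 1] := by
  rw [chiSquareLaw, variance_map (by fun_prop) (Measurable.aemeasurable (by fun_prop))]
  have h := variance_sum_pi (μ := fun _ : Fin k => gaussianReal 0 1)
    (X := fun _ x => x ^ 2) fun _ => memLp_sq_gaussianReal
  simp only [Finset.sum_const, Finset.card_univ, Fintype.card_fin, nsmul_eq_mul] at h
  rw [← h]
  congr 1
  funext z
  simp

lemma integral_abs_chiSquareLaw_sub_le (k : ℕ) :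
    ∫ v, |v - k| ∂chiSquareLaw k ≤ √(k * Var[fun x => x ^ 2; gaussianReal 0 1]) := by
  apply Real.le_sqrt_of_sq_le
  have hL : MemLp (fun v : ℝ => |v - k|) 2 (chiSquareLaw k) :=
    ((memLp_id_chiSquareLaw k).sub (memLp_const (k : ℝ))).abs
  have h := variance_nonneg (fun v : ℝ => |v - k|) (chiSquareLaw k)
  rw [variance_eq_sub hL] at h
  rw [← variance_id_chiSquareLaw, variance_eq_integral (by fun_prop), integral_id_chiSquareLaw]
  simp only [Pi.pow_apply, sq_abs] at h
  linarith

/-- The distribution function of Student's `t`-distribution is uniformly close to the standard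
normal one, at the rate at which `χ²_k / k` concentrates at one. -/
lemma abs_studentTCDF_sub_cdf_gaussianReal_le {k : ℕ} (hk : 0 < k) (x : ℝ) :
    |studentTCDF k x - cdf (gaussianReal 0 1) x| ≤
      2 * √(Var[fun x => x ^ 2; gaussianReal 0 1] / k) := by
  have hk' : (0 : ℝ) < k := by exact_mod_cast hk
  set C := Var[fun x => x ^ 2; gaussianReal 0 1]
  have hint : Integrable (fun v : ℝ => |v - k|) (chiSquareLaw k) :=
    (((memLp_id_chiSquareLaw k).integrable (by norm_num)).sub (integrable_const (k : ℝ))).abs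
  have hF : Integrable (fun v => cdf (gaussianReal 0 1) (x * √(v / k))) (chiSquareLaw k) := by
    refine Integrable.of_bound
      ((monotone_cdf _).measurable.comp (by fun_prop)).aestronglyMeasurable 1
      (Eventually.of_forall fun v => ?_)
    rw [Real.norm_eq_abs, abs_of_nonneg (cdf_nonneg _ _)]
    exact cdf_le_one _ _
  have hconst : cdf (gaussianReal 0 1) x =
      ∫ _, cdf (gaussianReal 0 1) x ∂chiSquareLaw k := by simp
  rw [studentTCDF_eq_integral hk, hconst, ← integral_sub hF (integrable_const _)]
  refine abs_integral_le_integral_abs.trans ?_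
  calc _ ≤ ∫ v, 2 / k * |v - k| ∂chiSquareLaw k := by
        refine integral_mono_ae (hF.sub (integrable_const _)).abs (hint.const_mul _) ?_
        filter_upwards [ae_chiSquareLaw_pos hk] with v hv
        refine (abs_cdf_gaussianReal_mul_sub_le x _).trans ?_
        have h0 : 0 ≤ v / k := by positivity
        -- `|√w - 1| ≤ |√w - 1| * (√w + 1) = |w - 1|`.
        have h1 : |√(v / k) - 1| ≤ |v / k - 1| := by
          have h2 : v / k - 1 = (√(v / k) - 1) * (√(v / k) + 1) := by
            nlinarith [Real.sq_sqrt h0]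
          rw [h2, abs_mul]
          refine le_mul_of_one_le_right (abs_nonneg _) ?_
          rw [abs_of_nonneg (by positivity)]
          linarith [Real.sqrt_nonneg (v / k)]
        rw [show v / k - 1 = (v - k) / k by field_simp, abs_div, abs_of_pos hk'] at h1
        calc _ ≤ 2 * (|v - k| / k) := by gcongr
          _ = _ := by ring
    _ ≤ 2 / k * √(k * C) := by
        rw [integral_const_mul]
        gcongr
        exact integral_abs_chiSquareLaw_sub_le k
    _ = 2 * √(C / k) := by
        have h3 : C / k = k * C / k ^ 2 := by field_simp
        rw [h3, Real.sqrt_div' _ (by positivity), Real.sqrt_sq hk'.le]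
        ring

/-! ### Law of the studentized mean -/

lemma map_pi_gaussianReal_sampleMean {n : ℕ} (hn : n ≠ 0) :
    (Measure.pi fun _ : Fin n => gaussianReal 0 1).map (fun z => √(n : ℝ) * sampleMean z) =
      gaussianReal 0 1 := by
  obtain ⟨k, rfl⟩ := Nat.exists_eq_succ_of_ne_zero hn
  have h := congrArg (Measure.map Prod.fst) (map_pi_gaussianReal_sampleMean_sumSq k)
  rwa [Measure.map_map (by fun_prop) (by unfold sampleMean; fun_prop), Measure.map_fst_prod,
    measure_univ, one_smul] at h

lemma map_pi_gaussianReal_sampleSD {n : ℕ} (hn : 2 ≤ n) :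
    (Measure.pi fun _ : Fin n => gaussianReal 0 1).map
      (fun z => √(n : ℝ) * sampleMean z / sampleSD z) = studentTLaw (n - 1) := by
  obtain ⟨k, rfl⟩ : ∃ k, n = k + 1 := ⟨n - 1, by omega⟩
  rw [studentTLaw, Nat.add_sub_cancel, ← map_pi_gaussianReal_sampleMean_sumSq,
    Measure.map_map (by fun_prop) (by unfold sampleMean; fun_prop)]
  congr 1
  funext z
  simp [sampleSD]

lemma ae_sampleSD_pos {n : ℕ} (hn : 2 ≤ n) :
    ∀ᵐ z ∂(Measure.pi fun _ : Fin n => gaussianReal 0 1), 0 < sampleSD z := by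
  obtain ⟨k, rfl⟩ : ∃ k, n = k + 1 := ⟨n - 1, by omega⟩
  have hk : 0 < k := by omega
  have hk' : (0 : ℝ) < k := by exact_mod_cast hk
  have h := congrArg (Measure.map Prod.snd) (map_pi_gaussianReal_sampleMean_sumSq k)
  rw [Measure.map_map (by fun_prop) (by unfold sampleMean; fun_prop), Measure.map_snd_prod,
    measure_univ, one_smul] at h
  have h2 := ae_chiSquareLaw_pos hk
  rw [← h] at h2
  filter_upwards [ae_of_ae_map (by unfold sampleMean; fun_prop) h2] with z hz
  refine Real.sqrt_pos.2 (div_pos hz ?_)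
  simpa using hk'

lemma measurable_sampleMean {n : ℕ} : Measurable (sampleMean : (Fin n → ℝ) → ℝ) := by
  unfold sampleMean; fun_prop

lemma measurable_sampleSD {n : ℕ} : Measurable (sampleSD : (Fin n → ℝ) → ℝ) := by
  unfold sampleSD sampleMean; fun_prop

/-! ### Measurability and inclusions of the coverage events -/

lemma measurable_softThreshold {Ω : Type*} [MeasurableSpace Ω] {f g : Ω → ℝ} (hf : Measurable f)
    (hg : Measurable g) (hf0 : ∀ ω, 0 ≤ f ω) :
    Measurable fun ω => softThreshold (f ω) (g ω) := by
  simp only [fun ω => softThreshold_eq (hf0 ω) (g ω)]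
  fun_prop

lemma measurableSet_mem_interval {Ω : Type*} [MeasurableSpace Ω] {f g : Ω → ℝ}
    (hf : Measurable f) (hg : Measurable g) (θ : ℝ) {I : ℝ → ℝ → Set ℝ}
    (hI : I = Set.Icc ∨ I = Set.Ioo ∨ I = Set.Ioc ∨ I = Set.Ico) :
    MeasurableSet {ω | θ ∈ I (f ω) (g ω)} := by
  have h1 : MeasurableSet {ω | f ω ≤ θ} := measurableSet_le hf measurable_const
  have h2 : MeasurableSet {ω | f ω < θ} := measurableSet_lt hf measurable_const
  have h3 : MeasurableSet {ω | θ ≤ g ω} := measurableSet_le measurable_const hg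
  have h4 : MeasurableSet {ω | θ < g ω} := measurableSet_lt measurable_const hg
  rcases hI with rfl | rfl | rfl | rfl
  exacts [h1.inter h3, h2.inter h4, h2.inter h3, h1.inter h4]

lemma Ioo_subset_interval {I : ℝ → ℝ → Set ℝ}
    (hI : I = Set.Icc ∨ I = Set.Ioo ∨ I = Set.Ioc ∨ I = Set.Ico) (l u : ℝ) :
    Set.Ioo l u ⊆ I l u := by
  rcases hI with rfl | rfl | rfl | rfl
  exacts [Set.Ioo_subset_Icc_self, subset_rfl, Set.Ioo_subset_Ioc_self, Set.Ioo_subset_Ico_self]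

lemma interval_subset_Icc {I : ℝ → ℝ → Set ℝ}
    (hI : I = Set.Icc ∨ I = Set.Ioo ∨ I = Set.Ioc ∨ I = Set.Ico) (l u : ℝ) :
    I l u ⊆ Set.Icc l u := by
  rcases hI with rfl | rfl | rfl | rfl
  exacts [subset_rfl, Set.Ioo_subset_Icc_self, Set.Ioc_subset_Icc_self, Set.Ico_subset_Icc_self]

/-! ### Minimal coverage probabilities in the Gaussian sample -/

theorem infCoverageUnknown_eq {σ η a : ℝ} (hσ : 0 < σ) (hη : 0 < η) (ha : 0 ≤ a)
    {I : ℝ → ℝ → Set ℝ} (hI : I = Set.Icc ∨ I = Set.Ioo ∨ I = Set.Ioc ∨ I = Set.Ico)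
    {n : ℕ} (hn : 2 ≤ n) :
    infCoverageUnknown I n σ η a =
      studentTCDF (n - 1) (√(n : ℝ) * (a - η)) - studentTCDF (n - 1) (√(n : ℝ) * (-a - η)) := by
  have hn0 : n ≠ 0 := by omega
  have hm : Measurable fun y : Fin n → ℝ => softFeasible η y :=
    measurable_softThreshold (measurable_sampleSD.mul_const η) measurable_sampleMean
      fun y => mul_nonneg (Real.sqrt_nonneg _) hη.le
  have hna := nullSingletonClass_studentTLaw (k := n - 1) (by omega)
  have hlaw : (Measure.pi fun _ : Fin n => gaussianReal 0 1).map
      (fun z => √(n : ℝ) * (σ * sampleMean z) / (σ * sampleSD z)) = studentTLaw (n - 1) := by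
    rw [← map_pi_gaussianReal_sampleSD hn]
    congr 1
    funext z
    rw [mul_left_comm, mul_div_mul_left _ _ hσ.ne']
  unfold studentTCDF
  rw [← iInf_coverage_softThreshold (measurable_sampleMean.const_mul σ)
    (measurable_sampleSD.const_mul σ) (fun z => mul_nonneg hσ.le (Real.sqrt_nonneg _))
    ((ae_sampleSD_pos hn).mono fun z hz => mul_pos hσ hz) (by positivity) hlaw
    (studentTLaw_map_neg _) hη ha (Ioo_subset_interval hI) (interval_subset_Icc hI)]
  refine iInf_congr fun θ => ?_
  have hset : MeasurableSet {y : Fin n → ℝ |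
      θ ∈ I (softFeasible η y - sampleSD y * a) (softFeasible η y + sampleSD y * a)} :=
    measurableSet_mem_interval (hm.sub (measurable_sampleSD.mul_const a))
      (hm.add (measurable_sampleSD.mul_const a)) θ hI
  rw [sampleLaw_eq_map, map_measureReal_apply (by fun_prop) hset]
  simp only [softFeasible, Set.preimage_ofPred_eq, sampleMean_affine hn0,
    sampleSD_affine hn0 θ hσ.le]

theorem infCoverageKnown_eq {σ η a : ℝ} (hσ : 0 < σ) (hη : 0 < η) (ha : 0 ≤ a)
    {I : ℝ → ℝ → Set ℝ} (hI : I = Set.Icc ∨ I = Set.Ioo ∨ I = Set.Ioc ∨ I = Set.Ico)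
    {n : ℕ} (hn : n ≠ 0) :
    infCoverageKnown I n σ η a =
      cdf (gaussianReal 0 1) (√(n : ℝ) * (a - η)) -
        cdf (gaussianReal 0 1) (√(n : ℝ) * (-a - η)) := by
  have hm : Measurable fun y : Fin n → ℝ => softInfeasible σ η y :=
    measurable_softThreshold measurable_const measurable_sampleMean
      fun y => mul_nonneg hσ.le hη.le
  have hna := nullSingletonClass_gaussianReal (μ := 0) (v := 1) one_ne_zero
  have hlaw : (Measure.pi fun _ : Fin n => gaussianReal 0 1).map
      (fun z => √(n : ℝ) * (σ * sampleMean z) / σ) = gaussianReal 0 1 := by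
    simp only [mul_left_comm _ σ, mul_div_cancel_left₀ _ hσ.ne']
    exact map_pi_gaussianReal_sampleMean hn
  rw [← iInf_coverage_softThreshold (S := fun _ => σ) (measurable_sampleMean.const_mul σ)
    measurable_const (fun _ => hσ.le) (Eventually.of_forall fun _ => hσ) (by positivity) hlaw
    gaussianReal_zero_map_neg hη ha (Ioo_subset_interval hI) (interval_subset_Icc hI)]
  refine iInf_congr fun θ => ?_
  rw [sampleLaw_eq_map, map_measureReal_apply (by fun_prop)
    (measurableSet_mem_interval (hm.sub_const _) (hm.add_const _) θ hI)]
  simp only [softInfeasible, Set.preimage_ofPred_eq, sampleMean_affine hn]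

theorem mainTheorem5 (σ : ℝ) (hσ : 0 < σ) (η a : ℕ → ℝ) (hη : ∀ n, 0 < η n) (ha : ∀ n, 0 ≤ a n)
    (I : ℝ → ℝ → Set ℝ)
    (hI : I = Set.Icc ∨ I = Set.Ioo ∨ I = Set.Ioc ∨ I = Set.Ico) :
    (∀ n : ℕ, 2 ≤ n →
      infCoverageUnknown I n σ (η n) (a n) =
        studentTCDF (n - 1) (√(n : ℝ) * (a n - η n)) -
          studentTCDF (n - 1) (√(n : ℝ) * (-a n - η n))) ∧
    Tendsto
      (fun n : ℕ => infCoverageUnknown I n σ (η n) (a n) - infCoverageKnown I n σ (η n) (a n))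
      atTop (𝓝 0) := by
  refine ⟨fun n hn => infCoverageUnknown_eq hσ (hη n) (ha n) hI hn, ?_⟩
  set C := Var[fun x : ℝ => x ^ 2; gaussianReal 0 1]
  have hlim : Tendsto (fun n : ℕ => 4 * √(C / ((n - 1 : ℕ) : ℝ))) atTop (𝓝 0) := by
    have h := (tendsto_const_div_atTop_nhds_zero_nat C).comp (tendsto_sub_atTop_nat 1)
    simpa using (h.sqrt).const_mul 4
  refine squeeze_zero_norm' ?_ hlim
  filter_upwards [eventually_ge_atTop 2] with n hn
  rw [infCoverageUnknown_eq hσ (hη n) (ha n) hI hn,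
    infCoverageKnown_eq hσ (hη n) (ha n) hI (by omega), Real.norm_eq_abs]
  have h1 := abs_le.1 (abs_studentTCDF_sub_cdf_gaussianReal_le (k := n - 1) (by omega)
    (√(n : ℝ) * (a n - η n)))
  have h2 := abs_le.1 (abs_studentTCDF_sub_cdf_gaussianReal_le (k := n - 1) (by omega)
    (√(n : ℝ) * (-a n - η n)))
  rw [abs_le]
  constructor <;> linarith [h1.1, h1.2, h2.1, h2.2]
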